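/- Let $E$ be a Polish space and let $X=(X_t)_{t\ge 0}$ be a (conservative, time-homogeneous) Feller process on $E$, with laws $\mathbb P_x$ ($x\in E$) on the space of càdlàg paths and semigroup $S_tf(x)=\mathbb E_x f(X_t)$; write $\delta_xS_t$ for the law of $X_t$ under $\mathbb P_x$. Let $\rho:E\times E\to[0,\infty]$ be a lower semicontinuous metric (possibly taking the value $\infty$, and not necessarily inducing the topology of $E$). For $f:E\to\mathbb R$ put $$\|f\|_{Lip}=\inf\{r\ge 0:\ f(x)-f(y)\le r\,\rho(x,y)\ \text{for all } x,y\in E\},\qquad \|S_t\|_{Lip}=\sup\{\|S_tf\|_{Lip}:\ \|f\|_{Lip}\le 1\},$$ where the supremum is over all Borel measurable $f$ that are integrable with respect to $\delta_xS_t$ for every $x\in E$. Define the optimal coupling distance and the generalized coupling time by $$\rho_t(x,y)=\inf_{\pi}\int\rho(x',y')\,\pi(dx'\,dy'),\qquad h(x,y)=\int_0^\infty\rho_t(x,y)\,dt,$$ where the infimum is over all couplings $\pi$ of $\delta_xS_t$ and $\delta_yS_t$. Assume that $X$ acts as a contraction for $\rho$, i.e. $\rho_t(x,y)\le\rho(x,y)$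 for all $t\ge0$ and $x,y\in E$, and that there is a constant $M\in(0,\infty)$ with $h(x,y)\le M\rho(x,y)$ for all $x,y\in E$. Then the limit $\lim_{t\to\infty}\frac1t\log\|S_t\|_{Lip}$ exists in $[-\infty,\infty]$ (with $\log 0=-\infty$), and $$\lim_{t\to\infty}\frac1t\log\|S_t\|_{Lip}\le-\frac1M .$$ -/

import Mathlib

open MeasureTheory ProbabilityTheory Filter Topology
open scoped NNReal ENNReal BoundedContinuousFunction

noncomputable section

namespace CouplingTime

/-- `ω` is right-continuous on `[0,∞)` and has left limits in `E` on `(0,∞)`. -/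
def IsCadlag {E : Type*} [TopologicalSpace E] (ω : ℝ≥0 → E) : Prop :=
  ∀ t : ℝ≥0, ContinuousWithinAt ω (Set.Ici t) t ∧ ∃ l : E, Tendsto ω (𝓝[<] t) (𝓝 l)

/-- The space `D_{[0,∞[}(E)` of càdlàg trajectories in `E`. -/
def CadlagPath (E : Type*) [TopologicalSpace E] : Type _ :=
  {ω : ℝ≥0 → E // IsCadlag ω}

section Paths

variable {E : Type*} [TopologicalSpace E]

theorem isCadlag_shift (s : ℝ≥0) {ω : ℝ≥0 → E} (hω : IsCadlag ω) :
    IsCadlag fun u => ω (s + u) := by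
  intro t
  obtain ⟨hr, l, hl⟩ := hω (s + t)
  have hc : Continuous fun u : ℝ≥0 => s + u := by fun_prop
  refine ⟨?_, l, ?_⟩
  · refine ContinuousWithinAt.comp (f := fun u : ℝ≥0 => s + u) (t := Set.Ici (s + t)) hr
      hc.continuousWithinAt ?_
    intro u hu
    exact add_le_add_right (Set.mem_Ici.1 hu) s
  · refine hl.comp ?_
    refine tendsto_nhdsWithin_of_tendsto_nhds_of_eventually_within _
      (hc.continuousAt.tendsto.mono_left nhdsWithin_le_nhds) ?_
    filter_upwards [self_mem_nhdsWithin] with u hu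
    exact add_lt_add_right (Set.mem_Iio.1 hu) s

/-- The coordinate map `X_t` on path space. -/
def CadlagPath.coord (t : ℝ≥0) (ω : CadlagPath E) : E := ω.1 t

/-- The time shift `θ_s` on path space, `(θ_s ω)(u) = ω(s + u)`. -/
def CadlagPath.shift (s : ℝ≥0) (ω : CadlagPath E) : CadlagPath E :=
  ⟨fun u => ω.1 (s + u), isCadlag_shift s ω.2⟩

variable [MeasurableSpace E]

/-- The σ-algebra on path space generated by all coordinate maps. -/
instance CadlagPath.measurableSpace : MeasurableSpace (CadlagPath E) :=
  ⨆ t : ℝ≥0, MeasurableSpace.comap (CadlagPath.coord t) inferInstance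

/-- The canonical filtration `𝓕_t = σ(X_s ; 0 ≤ s ≤ t)`. -/
@[reducible]
def canonicalSigma (E : Type*) [TopologicalSpace E] [MeasurableSpace E] (t : ℝ≥0) :
    MeasurableSpace (CadlagPath E) :=
  ⨆ s : ℝ≥0, ⨆ _ : s ≤ t, MeasurableSpace.comap (CadlagPath.coord s) inferInstance

end Paths

/-- A (conservative, time-homogeneous) Feller process with state space `E`, given by the family
`x ↦ ℙ_x` of its laws on càdlàg path space. -/
structure FellerProcess (E : Type*) [TopologicalSpace E] [MeasurableSpace E] where
  /-- `law x` is the law `ℙ_x` of the process started in `x`. -/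
  law : Kernel E (CadlagPath E)
  isMarkovKernel : IsMarkovKernel law
  /-- The process starts in `x` under `ℙ_x`. -/
  start : ∀ x, ∀ᵐ ω ∂(law x), CadlagPath.coord 0 ω = x
  /-- Markov property: under `ℙ_x`, the conditional law of `θ_s X` given `𝓕_s` is `ℙ_{X_s}`. -/
  markov : ∀ (x : E) (s : ℝ≥0) (B A : Set (CadlagPath E)),
    MeasurableSet[canonicalSigma E s] B → MeasurableSet A →
      law x (B ∩ CadlagPath.shift s ⁻¹' A) = ∫⁻ ω in B, law (CadlagPath.coord s ω) A ∂(law x)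
  /-- Feller property: `x ↦ 𝔼_x f(X_t)` is continuous for `f` bounded and continuous. -/
  feller : ∀ (t : ℝ≥0) (f : E →ᵇ ℝ), Continuous fun x => ∫ ω, f (CadlagPath.coord t ω) ∂(law x)

/-- `ρ : E × E → [0,∞]` is a lower semicontinuous semi-metric. -/
structure IsLscSemimetric {E : Type*} [TopologicalSpace E] (ρ : E → E → ℝ≥0∞) : Prop where
  lsc : LowerSemicontinuous fun p : E × E => ρ p.1 p.2
  self : ∀ x, ρ x x = 0
  symm : ∀ x y, ρ x y = ρ y x
  triangle : ∀ x y z, ρ x z ≤ ρ x y + ρ y z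

/-- `ρ : E × E → [0,∞]` is a lower semicontinuous metric. It need not induce the topology of `E`. -/
structure IsLscMetric {E : Type*} [TopologicalSpace E] (ρ : E → E → ℝ≥0∞) : Prop
    extends IsLscSemimetric ρ where
  eq_of_zero : ∀ x y, ρ x y = 0 → x = y

/-- The Lipschitz seminorm `‖f‖_Lip = inf {r ≥ 0 | f x - f y ≤ r ρ(x,y) for all x, y}`
(equal to `∞` if there is no such `r`). -/
def lipSeminorm {E : Type*} (ρ : E → E → ℝ≥0∞) (f : E → ℝ) : ℝ≥0∞ :=
  ⨅ (r : ℝ≥0) (_ : ∀ x y, ENNReal.ofReal (f x - f y) ≤ r * ρ x y), (r : ℝ≥0∞)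

namespace FellerProcess

variable {E : Type*} [TopologicalSpace E] [MeasurableSpace E] (X : FellerProcess E)

/-- `δ_x S_t`, the law of `X_t` for the process started in `x`. -/
def marginal (t : ℝ≥0) (x : E) : Measure E := (X.law x).map (CadlagPath.coord t)

/-- The semigroup `(S_t f)(x) = 𝔼_x f(X_t)`. -/
def semigroup (t : ℝ≥0) (f : E → ℝ) (x : E) : ℝ := ∫ z, f z ∂(X.marginal t x)

/-- `‖S_t‖_Lip`, the operator seminorm of `S_t` with respect to `‖·‖_Lip`: the supremum of
`‖S_t f‖_Lip` over the measurable functions `f` with `‖f‖_Lip ≤ 1` for which `S_t f` is defined. -/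
def semigroupLipNorm (ρ : E → E → ℝ≥0∞) (t : ℝ≥0) : ℝ≥0∞ :=
  ⨆ (f : E → ℝ) (_ : Measurable f) (_ : ∀ x, Integrable f (X.marginal t x))
    (_ : lipSeminorm ρ f ≤ 1), lipSeminorm ρ (X.semigroup t f)

/-- The optimal coupling distance `ρ_t(x,y)`: the infimum of `∫ ρ dπ` over all couplings `π` of
`δ_x S_t` and `δ_y S_t`. -/
def couplingDist (ρ : E → E → ℝ≥0∞) (t : ℝ≥0) (x y : E) : ℝ≥0∞ :=
  ⨅ (π : Measure (E × E)) (_ : π.map Prod.fst = X.marginal t x)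
    (_ : π.map Prod.snd = X.marginal t y), ∫⁻ p, ρ p.1 p.2 ∂π

/-- The generalized coupling time `h(x,y) = ∫_0^∞ ρ_t(x,y) dt`. -/
def genCouplingTime (ρ : E → E → ℝ≥0∞) (x y : E) : ℝ≥0∞ :=
  ∫⁻ t in Set.Ici (0 : ℝ), X.couplingDist ρ t.toNNReal x y

/-- The process acts as a contraction for the distance `ρ`. -/
def IsContraction (ρ : E → E → ℝ≥0∞) : Prop :=
  ∀ (t : ℝ≥0) (x y : E), X.couplingDist ρ t x y ≤ ρ x y

end FellerProcess

end CouplingTime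

end

namespace CouplingTime

/-! Work with the dual distance `D_t = dualDist`, a supremum over test functions, instead of
couplings. The easy half of Kantorovich duality gives `D_t ≤ ρ_t`, so the bound on `h` passes to
`D`. Near-optimal test functions can be summed and pushed through the semigroup, so no couplings
have to be glued.

Contraction makes `D_t` antitone in `t`, so a Riemann sum with mesh `d` gives `∑ D_{(j+1)d} ≤ (M/d)
ρ`. If `f_j` is nearly optimal for the `j`-th term, `∑ S_{(j+1)d} f_j` is `M/d`-Lipschitz. Applying
`S_{Td}` to it gives `∑ D_{(T+1+j)d} ≤ (M/d) D_{Td}` (`sum_dualDist_le`): each tail is controlled by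
the term before it. This forces geometric decay with ratio `M/(M+d)` per time `d`, and the rate
`(1/d) log (M/(M+d))` tends to `-1/M` as `d → 0`.

`‖S_t‖_Lip` is the best constant in `D_t ≤ C ρ` and is submultiplicative, so by Fekete the limit
exists and equals an infimum, which any single good time bounds. -/

/-! ### Real-variable estimates: geometric decay, Fekete, Riemann sums. -/

/-- For tails `R_T = ∑_{k>T} a_k` the hypothesis reads `R_{T+1} ≤ K (R_T - R_{T+1})`, hence `R_{T+1}
≤ K/(1+K) R_T`. Finite sums of every length `N` avoid any question of convergence. -/
theorem sum_range_le_geometric_of_sum_le {a : ℕ → ℝ} {K : ℝ} (hK : 0 < K)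
    (h : ∀ T N : ℕ, ∑ j ∈ Finset.range N, a (T + 1 + j) ≤ K * a T) (T N : ℕ) :
    ∑ j ∈ Finset.range N, a (T + 1 + j) ≤ (K / (1 + K)) ^ T * (K * a 0) := by
  induction T generalizing N with
  | zero => simpa using h 0 N
  | succ T ih =>
    have h1 := ih (N + 1)
    rw [Finset.sum_range_succ'] at h1
    have h2 := h (T + 1) N
    have h3 : ∑ j ∈ Finset.range N, a (T + 1 + (j + 1)) =
        ∑ j ∈ Finset.range N, a (T + 1 + 1 + j) :=
      Finset.sum_congr rfl fun j _ => by congr 1; omega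
    rw [h3, add_zero] at h1
    set s := ∑ j ∈ Finset.range N, a (T + 1 + 1 + j)
    rw [pow_succ, mul_comm _ (K / (1 + K)), mul_assoc, div_mul_eq_mul_div,
      le_div_iff₀ (by linarith)]
    have := mul_le_mul_of_nonneg_left h1 hK.le
    linarith

theorem le_geometric_of_sum_le {a : ℕ → ℝ} {K : ℝ} (hK : 0 < K)
    (h : ∀ T N : ℕ, ∑ j ∈ Finset.range N, a (T + 1 + j) ≤ K * a T) (T : ℕ) :
    a (T + 1) ≤ (K / (1 + K)) ^ T * (K * a 0) := by
  simpa using sum_range_le_geometric_of_sum_le hK h T 1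

theorem inv_mul_log_le_iff {t : ℝ} (ht : 0 < t) (p : ℝ≥0∞) (b : ℝ) :
    ((1 / t : ℝ) : EReal) * ENNReal.log p ≤ (b : EReal) ↔ p ≤ ENNReal.ofReal (Real.exp (b * t)) := by
  rw [← ENNReal.log_rpow, ← EReal.log_exp (b : EReal), ENNReal.log_le_log_iff, EReal.exp_coe,
    one_div, ENNReal.rpow_inv_le_iff ht, ENNReal.ofReal_rpow_of_pos (Real.exp_pos b),
    ← Real.exp_mul]

/-- Fekete's lemma for submultiplicative functions of continuous time that are bounded by one. -/
theorem tendsto_inv_mul_log_of_submultiplicative {φ : ℝ≥0 → ℝ≥0∞} (h1 : ∀ t, φ t ≤ 1)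
    (hmul : ∀ s t, φ (s + t) ≤ φ s * φ t) :
    Tendsto (fun t : ℝ≥0 => ((1 / (t : ℝ) : ℝ) : EReal) * ENNReal.log (φ t)) atTop
      (𝓝 (⨅ t : ℝ≥0, ⨅ _ : 0 < t, ((1 / (t : ℝ) : ℝ) : EReal) * ENNReal.log (φ t))) := by
  set L : EReal := ⨅ t : ℝ≥0, ⨅ _ : 0 < t, ((1 / (t : ℝ) : ℝ) : EReal) * ENNReal.log (φ t)
    with hL
  refine tendsto_order.2 ⟨fun l hl => ?_, fun a ha => ?_⟩
  · filter_upwards [eventually_gt_atTop 0] with t ht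
    exact hl.trans_le (iInf₂_le t ht)
  by_cases ha0 : 0 < a
  · filter_upwards [eventually_gt_atTop 0] with t ht
    refine lt_of_le_of_lt ?_ ha0
    have := (inv_mul_log_le_iff (NNReal.coe_pos.2 ht) (φ t) 0).2 (by simpa using h1 t)
    simpa using this
  obtain ⟨b, hLb, hba⟩ := EReal.lt_iff_exists_real_btwn.1 ha
  obtain ⟨c, hbc, hca⟩ := EReal.lt_iff_exists_real_btwn.1 hba
  have hbc' : b < c := EReal.coe_lt_coe_iff.1 hbc
  have hc0 : c < 0 := EReal.coe_lt_coe_iff.1 (hca.trans_le (not_lt.1 ha0))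
  obtain ⟨s, hs⟩ := iInf_lt_iff.1 hLb
  obtain ⟨hs0, hs⟩ := iInf_lt_iff.1 hs
  have hsr : (0 : ℝ) < s := NNReal.coe_pos.2 hs0
  have hφs := (inv_mul_log_le_iff hsr (φ s) b).1 hs.le
  have hpow : ∀ n : ℕ, ∀ r : ℝ≥0, φ (n * s + r) ≤ ENNReal.ofReal (Real.exp (b * s)) ^ n := by
    intro n
    induction n with
    | zero => intro r; simpa using h1 r
    | succ n ih =>
      intro r
      have he : ((n + 1 : ℕ) : ℝ≥0) * s + r = s + (n * s + r) := by push_cast; ring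
      rw [he, pow_succ']
      exact (hmul _ _).trans (mul_le_mul' hφs (ih r))
  -- This threshold is `b (t - s) ≤ c t` solved for `t`, with `b - c < 0`. Since `n s > t - s` and
  -- `b < 0`, it yields `b n s ≤ c t`.
  have hev : ∀ᶠ t : ℝ≥0 in atTop, b * s / (b - c) ≤ t :=
    (NNReal.tendsto_coe_atTop.2 tendsto_id).eventually_ge_atTop _
  filter_upwards [eventually_gt_atTop 0, hev] with t ht0 ht
  have htr : (0 : ℝ) < t := NNReal.coe_pos.2 ht0
  refine lt_of_le_of_lt ((inv_mul_log_le_iff htr _ c).2 ?_) hca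
  set n := ⌊(t : ℝ) / s⌋₊
  have hn1 : (n : ℝ) * s ≤ t := (le_div_iff₀ hsr).1 (Nat.floor_le (by positivity))
  have hn2 : (t : ℝ) < (n + 1) * s := (div_lt_iff₀ hsr).1 (Nat.lt_floor_add_one _)
  have hn1' : (n : ℝ≥0) * s ≤ t := by exact_mod_cast hn1
  have := hpow n (t - n * s)
  rw [add_tsub_cancel_of_le hn1', ← ENNReal.ofReal_pow (Real.exp_pos _).le, ← Real.exp_nat_mul]
    at this
  refine this.trans (ENNReal.ofReal_le_ofReal (Real.exp_le_exp.2 ?_))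
  have h3 : (t : ℝ) * (b - c) ≤ b * s := (div_le_iff_of_neg (by linarith)).1 ht
  nlinarith

theorem exists_pos_inv_one_add_lt_exp {M b : ℝ} (hM : 0 < M) (hb : -(1 / M) < b) (hb0 : b < 0) :
    ∃ d : ℝ, 0 < d ∧ (M / d) / (1 + M / d) < Real.exp (b * d) := by
  have hMb : -(M * b) < 1 := by
    have := mul_lt_mul_of_pos_left hb hM
    have h2 : M * (-(1 / M)) = -1 := by field_simp
    linarith
  -- By `exp (b d) ≥ 1 + b d` it suffices that `1 + M b + b d > 0`; this `d` makes the left side `(1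
  -- + M b) / 2`.
  refine ⟨(1 + M * b) / (-2 * b), div_pos (by linarith) (by linarith), ?_⟩
  set d := (1 + M * b) / (-2 * b) with hd
  have hd0 : 0 < d := div_pos (by linarith) (by linarith)
  have hb' : b ≠ 0 := hb0.ne
  have hbd : b * d = -(1 + M * b) / 2 := by rw [hd]; field_simp
  have h1 : (M / d) / (1 + M / d) = M / (d + M) := by field_simp
  rw [h1, div_lt_iff₀ (by linarith)]
  have h2 : b * d + 1 ≤ Real.exp (b * d) := Real.add_one_le_exp _
  have h3 : (b * d + 1) * (d + M) ≤ Real.exp (b * d) * (d + M) :=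
    mul_le_mul_of_nonneg_right h2 (by linarith)
  nlinarith

theorem sum_mul_le_setLIntegral_of_antitone {g : ℝ≥0 → ℝ≥0∞} (hg : Antitone g) (d : ℝ≥0) (N : ℕ) :
    ∑ j ∈ Finset.range N, (d : ℝ≥0∞) * g ((j + 1 : ℕ) * d) ≤
      ∫⁻ t in Set.Ici (0 : ℝ), g t.toNNReal := by
  have hm : Monotone fun j : ℕ => (j : ℝ) * d := fun i j hij => by
    have : (i : ℝ) ≤ j := by exact_mod_cast hij
    exact mul_le_mul_of_nonneg_right this d.2
  have hdisj : Pairwise (Function.onFun Disjoint fun j : ℕ => Set.Ioc ((j : ℝ) * d) ((j + 1 : ℕ) * d)) := by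
    simpa using hm.pairwise_disjoint_on_Ioc_succ
  calc ∑ j ∈ Finset.range N, (d : ℝ≥0∞) * g ((j + 1 : ℕ) * d)
      ≤ ∑ j ∈ Finset.range N, ∫⁻ t in Set.Ioc ((j : ℝ) * d) ((j + 1 : ℕ) * d), g t.toNNReal := by
        refine Finset.sum_le_sum fun j _ => ?_
        have hv : (volume : Measure ℝ) (Set.Ioc ((j : ℝ) * d) ((j + 1 : ℕ) * d)) = d := by
          rw [Real.volume_Ioc]
          have : ((j + 1 : ℕ) : ℝ) * d - j * d = d := by push_cast; ring
          rw [this, ENNReal.ofReal_coe_nnreal]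
        rw [mul_comm, ← hv, ← setLIntegral_const]
        refine setLIntegral_mono' measurableSet_Ioc fun t ht => hg ?_
        rw [Real.toNNReal_le_iff_le_coe]
        exact_mod_cast ht.2
    _ = ∫⁻ t in ⋃ j ∈ Finset.range N, Set.Ioc ((j : ℝ) * d) ((j + 1 : ℕ) * d), g t.toNNReal := by
        rw [lintegral_biUnion_finset (fun i _ j _ hij => hdisj hij) fun _ _ => measurableSet_Ioc]
    _ ≤ ∫⁻ t in Set.Ici (0 : ℝ), g t.toNNReal := by
        refine lintegral_mono_set (Set.iUnion₂_subset fun j _ t ht => ?_)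
        exact (mul_nonneg (Nat.cast_nonneg j) d.2).trans ht.1.le

/-! ### Lipschitz test functions and the Lipschitz seminorm. -/

/-- Bounded measurable functions that are `K`-Lipschitz on all pairs at finite `ρ`-distance. -/
structure IsBddLip {E : Type*} [MeasurableSpace E] (ρ : E → E → ℝ≥0∞) (K : ℝ) (f : E → ℝ) :
    Prop where
  measurable : Measurable f
  bounded : ∃ C : ℝ, ∀ x, |f x| ≤ C
  lip : ∀ x y, ρ x y ≠ ∞ → f x - f y ≤ K * (ρ x y).toReal

namespace IsBddLip

variable {E : Type*} [MeasurableSpace E] {ρ : E → E → ℝ≥0∞}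

theorem zero : IsBddLip ρ 1 (fun _ => 0) :=
  ⟨measurable_const, ⟨0, by simp⟩, fun x y _ => by simp⟩

theorem integrable {K : ℝ} {f : E → ℝ} (hf : IsBddLip ρ K f) (μ : Measure E) [IsFiniteMeasure μ] :
    Integrable f μ := by
  obtain ⟨C, hC⟩ := hf.bounded
  exact Integrable.of_bound hf.measurable.aestronglyMeasurable C (Eventually.of_forall hC)

theorem inv_mul {K : ℝ} (hK : 0 < K) {f : E → ℝ} (hf : IsBddLip ρ K f) :
    IsBddLip ρ 1 fun x => K⁻¹ * f x := by
  obtain ⟨C, hC⟩ := hf.bounded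
  refine ⟨hf.measurable.const_mul _, ⟨K⁻¹ * C, fun x => ?_⟩, fun x y hxy => ?_⟩
  · rw [abs_mul, abs_of_pos (inv_pos.2 hK)]
    exact mul_le_mul_of_nonneg_left (hC x) (inv_pos.2 hK).le
  · rw [← mul_sub, inv_mul_le_iff₀ hK, one_mul]
    exact hf.lip x y hxy

end IsBddLip

theorem ofReal_le_mul_iff {a C : ℝ} {r : ℝ≥0∞} (hC : 0 ≤ C) (hr : r ≠ ∞) :
    ENNReal.ofReal a ≤ ENNReal.ofReal C * r ↔ a ≤ C * r.toReal := by
  rw [← ENNReal.ofReal_toReal hr, ← ENNReal.ofReal_mul hC,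
    ENNReal.ofReal_le_ofReal_iff (by positivity), ENNReal.toReal_ofReal ENNReal.toReal_nonneg]

theorem lipSeminorm_le_ofReal_iff {E : Type*} {ρ : E → E → ℝ≥0∞} {f : E → ℝ} {C : ℝ}
    (hC : 0 ≤ C) : lipSeminorm ρ f ≤ ENNReal.ofReal C ↔
      ∀ x y, ρ x y ≠ ∞ → f x - f y ≤ C * (ρ x y).toReal := by
  constructor
  · intro h x y hxy
    refine le_of_forall_gt_imp_ge_of_dense fun a ha => ?_
    have key : ∀ ε : ℝ, 0 < ε → f x - f y ≤ (C + ε) * (ρ x y).toReal := by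
      intro ε hε
      have hlt : lipSeminorm ρ f < ENNReal.ofReal (C + ε) :=
        h.trans_lt ((ENNReal.ofReal_lt_ofReal_iff (by linarith)).2 (by linarith))
      obtain ⟨r, hr⟩ := iInf_lt_iff.1 hlt
      obtain ⟨hr, hr2⟩ := iInf_lt_iff.1 hr
      exact (ofReal_le_mul_iff (by linarith) hxy).1 ((hr x y).trans (mul_le_mul_left hr2.le _))
    have hd : (0 : ℝ) ≤ (ρ x y).toReal := ENNReal.toReal_nonneg
    -- The `+ 1` keeps the denominator positive when the distance is zero.
    have h1 := key ((a - C * (ρ x y).toReal) / ((ρ x y).toReal + 1))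
      (div_pos (by linarith) (by linarith))
    have h2 : (a - C * (ρ x y).toReal) / ((ρ x y).toReal + 1) * (ρ x y).toReal ≤
        a - C * (ρ x y).toReal := by
      rw [div_mul_eq_mul_div, div_le_iff₀ (by linarith)]
      exact mul_le_mul_of_nonneg_left (by linarith) (by linarith)
    linarith
  · intro h
    refine ENNReal.le_of_forall_pos_le_add fun ε hε _ => ?_
    -- A positive constant is needed: with `0 * ∞ = 0`, the constant `0` would also constrain pairs
    -- at infinite distance.
    refine iInf₂_le_of_le (C.toNNReal + ε) (fun x y => ?_) (by simp [ENNReal.ofReal])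
    by_cases hxy : ρ x y = ∞
    · rw [hxy, ENNReal.mul_top (by simpa using fun _ => hε.ne')]
      exact le_top
    · refine ((ofReal_le_mul_iff hC hxy).2 (h x y hxy)).trans (mul_le_mul_left ?_ _)
      exact ENNReal.coe_le_coe.2 le_self_add

/-! ### Transition kernels and the semigroup. -/

namespace FellerProcess

variable {E : Type*} [TopologicalSpace E] [MeasurableSpace E] (X : FellerProcess E)

theorem measurable_coord (t : ℝ≥0) :
    Measurable (CadlagPath.coord t : CadlagPath E → E) := by
  rw [measurable_iff_comap_le]
  exact le_iSup (fun t : ℝ≥0 => MeasurableSpace.comap (CadlagPath.coord (E := E) t) inferInstance) t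

/-- The transition kernel `x ↦ δ_x S_t`. -/
noncomputable def transition (t : ℝ≥0) : Kernel E E := X.law.map (CadlagPath.coord t)

theorem transition_apply (t : ℝ≥0) (x : E) : X.transition t x = X.marginal t x :=
  Kernel.map_apply _ (measurable_coord t) x

instance (t : ℝ≥0) : IsMarkovKernel (X.transition t) :=
  haveI := X.isMarkovKernel
  Kernel.IsMarkovKernel.map _ (measurable_coord t)

instance (t : ℝ≥0) (x : E) : IsProbabilityMeasure (X.marginal t x) := by
  rw [← transition_apply]; infer_instance

theorem measurable_shift (s : ℝ≥0) :
    Measurable (CadlagPath.shift s : CadlagPath E → CadlagPath E) := by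
  refine Measurable.of_le_map (iSup_le fun t => ?_)
  rintro _ ⟨U, hU, rfl⟩
  exact measurable_coord (s + t) hU

theorem transition_comp (s t : ℝ≥0) :
    X.transition t ∘ₖ X.transition s = X.transition (s + t) := by
  ext x U hU
  rw [Kernel.comp_apply' _ _ _ hU, transition_apply, transition_apply, marginal, marginal,
    lintegral_map (Kernel.measurable_coe _ hU) (measurable_coord s),
    Measure.map_apply (measurable_coord _) hU]
  have h := X.markov x s Set.univ (CadlagPath.coord t ⁻¹' U) MeasurableSet.univ
    (measurable_coord t hU)
  rw [Set.univ_inter, Measure.restrict_univ] at h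
  rw [← Set.preimage_comp] at h
  refine Eq.trans (lintegral_congr fun ω => ?_) h.symm
  rw [transition_apply, marginal, Measure.map_apply (measurable_coord t) hU]

theorem semigroup_add {ρ : E → E → ℝ≥0∞} {K : ℝ} {f : E → ℝ} (hf : IsBddLip ρ K f) (s t : ℝ≥0) :
    X.semigroup (s + t) f = X.semigroup s (X.semigroup t f) := by
  ext x
  have hi : Integrable f ((X.transition t ∘ₖ X.transition s) x) := by
    rw [transition_comp, transition_apply]
    exact hf.integrable _
  have h := Kernel.integral_comp hi
  rw [transition_comp] at h
  simp only [transition_apply] at h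
  exact h

theorem measurable_semigroup {f : E → ℝ} (hf : Measurable f) (t : ℝ≥0) :
    Measurable (X.semigroup t f) := by
  have h := (hf.stronglyMeasurable.integral_kernel (κ := X.transition t)).measurable
  simp only [transition_apply] at h
  exact h

theorem abs_semigroup_le {f : E → ℝ} {C : ℝ} (hC : ∀ x, |f x| ≤ C) (t : ℝ≥0) (x : E) :
    |X.semigroup t f x| ≤ C := by
  have h := norm_integral_le_of_norm_le_const (μ := X.marginal t x) (f := f) (C := C)
    (Eventually.of_forall hC)
  simp only [Real.norm_eq_abs, probReal_univ, mul_one] at h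
  exact h

theorem semigroup_const_mul (c : ℝ) (f : E → ℝ) (t : ℝ≥0) (x : E) :
    X.semigroup t (fun z => c * f z) x = c * X.semigroup t f x :=
  integral_const_mul c f

/-! ### The dual distance and its decay. -/

/-- The dual distance: the supremum of `S_t f x - S_t f y` over bounded measurable 1-Lipschitz
functions `f`. -/
noncomputable def dualDist (ρ : E → E → ℝ≥0∞) (t : ℝ≥0) (x y : E) : ℝ :=
  sSup ((fun f => X.semigroup t f x - X.semigroup t f y) '' {f | IsBddLip ρ 1 f})

variable {X} {ρ : E → E → ℝ≥0∞}

theorem ofReal_semigroup_sub_le_couplingDist {f : E → ℝ} (hf : IsBddLip ρ 1 f) (t : ℝ≥0)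
    (x y : E) :
    ENNReal.ofReal (X.semigroup t f x - X.semigroup t f y) ≤ X.couplingDist ρ t x y := by
  refine le_iInf fun π => le_iInf fun h1 => le_iInf fun h2 => ?_
  have i1 : Integrable (fun p : E × E => f p.1) π :=
    (h1 ▸ hf.integrable (X.marginal t x) : Integrable f (π.map Prod.fst)).comp_measurable
      measurable_fst
  have i2 : Integrable (fun p : E × E => f p.2) π :=
    (h2 ▸ hf.integrable (X.marginal t y) : Integrable f (π.map Prod.snd)).comp_measurable
      measurable_snd
  have e : X.semigroup t f x - X.semigroup t f y = ∫ p, (f p.1 - f p.2) ∂π := by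
    rw [integral_sub i1 i2, semigroup, semigroup, ← h1, ← h2,
      integral_map measurable_fst.aemeasurable hf.measurable.aestronglyMeasurable,
      integral_map measurable_snd.aemeasurable hf.measurable.aestronglyMeasurable]
  rw [e]
  have i3 : Integrable (fun p : E × E => f p.1 - f p.2) π := i1.sub i2
  have h3 : ∫ p, (f p.1 - f p.2) ∂π ≤ ∫ p, max (f p.1 - f p.2) 0 ∂π :=
    integral_mono i3 i3.pos_part fun p => le_max_left _ _
  refine (ENNReal.ofReal_le_ofReal h3).trans ?_
  rw [ofReal_integral_eq_lintegral_ofReal i3.pos_part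
    (Eventually.of_forall fun p => le_max_right _ _)]
  refine lintegral_mono fun p => ?_
  by_cases hp : ρ p.1 p.2 = ∞
  · rw [hp]; exact le_top
  · refine ENNReal.ofReal_le_of_le_toReal (max_le ?_ ENNReal.toReal_nonneg)
    simpa using hf.lip _ _ hp

theorem semigroup_sub_le (hc : X.IsContraction ρ) {f : E → ℝ} (hf : IsBddLip ρ 1 f) (t : ℝ≥0)
    {x y : E} (hxy : ρ x y ≠ ∞) :
    X.semigroup t f x - X.semigroup t f y ≤ (ρ x y).toReal :=
  (ENNReal.ofReal_le_iff_le_toReal hxy).1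
    ((ofReal_semigroup_sub_le_couplingDist hf t x y).trans (hc t x y))

/-- Excludes the default value `0` of `sSup` on an unbounded set. -/
theorem bddAbove_dualDist (hc : X.IsContraction ρ) (t : ℝ≥0) {x y : E} (hxy : ρ x y ≠ ∞) :
    BddAbove ((fun f => X.semigroup t f x - X.semigroup t f y) '' {f | IsBddLip ρ 1 f}) := by
  refine ⟨(ρ x y).toReal, ?_⟩
  rintro _ ⟨f, hf, rfl⟩
  exact semigroup_sub_le hc hf t hxy

theorem semigroup_sub_le_dualDist (hc : X.IsContraction ρ) {f : E → ℝ} (hf : IsBddLip ρ 1 f)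
    (t : ℝ≥0) {x y : E} (hxy : ρ x y ≠ ∞) :
    X.semigroup t f x - X.semigroup t f y ≤ X.dualDist ρ t x y :=
  le_csSup (bddAbove_dualDist hc t hxy) ⟨f, hf, rfl⟩

theorem dualDist_le {t : ℝ≥0} {x y : E} {C : ℝ}
    (h : ∀ f, IsBddLip ρ 1 f → X.semigroup t f x - X.semigroup t f y ≤ C) :
    X.dualDist ρ t x y ≤ C := by
  refine csSup_le ⟨_, _, IsBddLip.zero, rfl⟩ ?_
  rintro _ ⟨f, hf, rfl⟩
  exact h f hf

theorem dualDist_nonneg (hc : X.IsContraction ρ) (t : ℝ≥0) {x y : E} (hxy : ρ x y ≠ ∞) :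
    0 ≤ X.dualDist ρ t x y := by
  simpa [semigroup] using semigroup_sub_le_dualDist hc IsBddLip.zero t hxy

theorem dualDist_le_dist (hc : X.IsContraction ρ) (t : ℝ≥0) {x y : E} (hxy : ρ x y ≠ ∞) :
    X.dualDist ρ t x y ≤ (ρ x y).toReal :=
  dualDist_le fun _ hf => semigroup_sub_le hc hf t hxy

theorem ofReal_dualDist_le_couplingDist (hc : X.IsContraction ρ) (t : ℝ≥0) {x y : E}
    (hxy : ρ x y ≠ ∞) : ENNReal.ofReal (X.dualDist ρ t x y) ≤ X.couplingDist ρ t x y := by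
  have hfin : X.couplingDist ρ t x y ≠ ∞ := ne_top_of_le_ne_top hxy (hc t x y)
  rw [ENNReal.ofReal_le_iff_le_toReal hfin]
  exact dualDist_le fun f hf => (ENNReal.ofReal_le_iff_le_toReal hfin).1
    (ofReal_semigroup_sub_le_couplingDist hf t x y)

theorem semigroup_sub_le_mul_dualDist (hc : X.IsContraction ρ) {K : ℝ} (hK : 0 < K) {f : E → ℝ}
    (hf : IsBddLip ρ K f) (t : ℝ≥0) {x y : E} (hxy : ρ x y ≠ ∞) :
    X.semigroup t f x - X.semigroup t f y ≤ K * X.dualDist ρ t x y := by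
  have h := semigroup_sub_le_dualDist hc (hf.inv_mul hK) t hxy
  rwa [semigroup_const_mul, semigroup_const_mul, ← mul_sub, inv_mul_le_iff₀ hK] at h

theorem isBddLip_semigroup {K : ℝ} {f : E → ℝ} (hf : IsBddLip ρ 1 f) {t : ℝ≥0}
    (h : ∀ x y, ρ x y ≠ ∞ → X.semigroup t f x - X.semigroup t f y ≤ K * (ρ x y).toReal) :
    IsBddLip ρ K (X.semigroup t f) :=
  ⟨X.measurable_semigroup hf.measurable t,
    hf.bounded.imp fun _ hC => X.abs_semigroup_le hC t, h⟩

/-- `S_{s+t} f = S_s (S_t f)`, and `S_t f` is a bounded `K`-Lipschitz test function for time `s`. -/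
theorem dualDist_add_le (hc : X.IsContraction ρ) {K : ℝ} (hK : 0 < K) {t : ℝ≥0}
    (h : ∀ x y, ρ x y ≠ ∞ → X.dualDist ρ t x y ≤ K * (ρ x y).toReal) (s : ℝ≥0) {x y : E}
    (hxy : ρ x y ≠ ∞) : X.dualDist ρ (s + t) x y ≤ K * X.dualDist ρ s x y := by
  refine dualDist_le fun f hf => ?_
  rw [semigroup_add X hf]
  exact semigroup_sub_le_mul_dualDist hc hK (isBddLip_semigroup hf fun x y hxy =>
    (semigroup_sub_le_dualDist hc hf t hxy).trans (h x y hxy)) s hxy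

theorem antitone_dualDist (hc : X.IsContraction ρ) {x y : E} (hxy : ρ x y ≠ ∞) :
    Antitone fun t => X.dualDist ρ t x y := by
  intro s t hst
  have h := dualDist_add_le hc one_pos (t := t - s)
    (fun x y h => by simpa using dualDist_le_dist hc (t - s) h) s hxy
  rwa [add_tsub_cancel_of_le hst, one_mul] at h

theorem sum_dualDist_le_dist (hc : X.IsContraction ρ) {M : ℝ} (hM : 0 < M)
    (hh : ∀ x y, X.genCouplingTime ρ x y ≤ ENNReal.ofReal M * ρ x y) {d : ℝ≥0} (hd : 0 < d)
    (N : ℕ) {x y : E} (hxy : ρ x y ≠ ∞) :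
    ∑ j ∈ Finset.range N, X.dualDist ρ ((j + 1 : ℕ) * d) x y ≤ M / d * (ρ x y).toReal := by
  have h1 := sum_mul_le_setLIntegral_of_antitone
    (g := fun t => ENNReal.ofReal (X.dualDist ρ t x y))
    (fun s t hst => ENNReal.ofReal_le_ofReal (antitone_dualDist hc hxy hst)) d N
  have hle : ∫⁻ t in Set.Ici (0 : ℝ), ENNReal.ofReal (X.dualDist ρ t.toNNReal x y) ≤
      X.genCouplingTime ρ x y :=
    lintegral_mono fun t => ofReal_dualDist_le_couplingDist hc t.toNNReal hxy
  have hd' : (0 : ℝ) < d := NNReal.coe_pos.2 hd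
  have h2 := h1.trans (hle.trans (hh x y))
  rw [← Finset.mul_sum, ← ENNReal.ofReal_sum_of_nonneg fun j _ => dualDist_nonneg hc _ hxy,
    ← ENNReal.ofReal_coe_nnreal, ← ENNReal.ofReal_mul hd'.le, ofReal_le_mul_iff hM.le hxy] at h2
  rw [div_mul_eq_mul_div, le_div_iff₀ hd']
  linarith

theorem sum_dualDist_le (hc : X.IsContraction ρ) {K : ℝ} (hK : 0 < K) {d : ℝ≥0} {N : ℕ}
    (h : ∀ x y, ρ x y ≠ ∞ →
      ∑ j ∈ Finset.range N, X.dualDist ρ ((j + 1 : ℕ) * d) x y ≤ K * (ρ x y).toReal)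
    (T : ℕ) {x y : E} (hxy : ρ x y ≠ ∞) :
    ∑ j ∈ Finset.range N, X.dualDist ρ ((T + 1 + j : ℕ) * d) x y ≤
      K * X.dualDist ρ (T * d) x y := by
  have key : ∀ ε : ℝ, 0 < ε → ∑ j ∈ Finset.range N, (X.dualDist ρ ((T + 1 + j : ℕ) * d) x y - ε) ≤
      K * X.dualDist ρ (T * d) x y := by
    intro ε hε
    -- The test function may depend on `j`: only the sum of the evolved functions has to be
    -- `K`-Lipschitz, and `h` bounds its increments term by term.
    have hex : ∀ j : ℕ, ∃ f, IsBddLip ρ 1 f ∧ X.dualDist ρ ((T + 1 + j : ℕ) * d) x y - ε <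
        X.semigroup ((T + 1 + j : ℕ) * d) f x - X.semigroup ((T + 1 + j : ℕ) * d) f y := by
      intro j
      obtain ⟨_, ⟨f, hf, rfl⟩, hlt⟩ := exists_lt_of_lt_csSup
        (s := (fun f => X.semigroup ((T + 1 + j : ℕ) * d) f x -
          X.semigroup ((T + 1 + j : ℕ) * d) f y) '' {f | IsBddLip ρ 1 f})
        ⟨_, _, IsBddLip.zero, rfl⟩ (sub_lt_self _ hε)
      exact ⟨f, hf, hlt⟩
    choose f hf hlt using hex
    have hg : ∀ j, IsBddLip ρ 1 (X.semigroup ((j + 1 : ℕ) * d) (f j)) := fun j =>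
      isBddLip_semigroup (hf j) fun x y hxy => by
        simpa using semigroup_sub_le hc (hf j) ((j + 1 : ℕ) * d) hxy
    have hsum : IsBddLip ρ K fun z => ∑ j ∈ Finset.range N, X.semigroup ((j + 1 : ℕ) * d) (f j) z := by
      choose C hC using fun j => (hg j).bounded
      refine ⟨Finset.measurable_fun_sum _ fun j _ => (hg j).measurable,
        ⟨∑ j ∈ Finset.range N, C j, fun z => (Finset.abs_sum_le_sum_abs _ _).trans
          (Finset.sum_le_sum fun j _ => hC j z)⟩, fun z w hzw => ?_⟩
      rw [← Finset.sum_sub_distrib]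
      exact (Finset.sum_le_sum fun j _ => semigroup_sub_le_dualDist hc (hf j) _ hzw).trans
        (h z w hzw)
    have hsg : ∀ z, X.semigroup (T * d)
        (fun z => ∑ j ∈ Finset.range N, X.semigroup ((j + 1 : ℕ) * d) (f j) z) z =
        ∑ j ∈ Finset.range N, X.semigroup ((T + 1 + j : ℕ) * d) (f j) z := by
      intro z
      have e : ∀ j : ℕ, ((T + 1 + j : ℕ) : ℝ≥0) * d = T * d + (j + 1 : ℕ) * d := fun j => by
        push_cast; ring
      simp only [e, semigroup_add X (hf _)]
      exact integral_finsetSum _ fun j _ => (hg j).integrable _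
    have hfin := semigroup_sub_le_mul_dualDist hc hK hsum (T * d) hxy
    rw [hsg, hsg, ← Finset.sum_sub_distrib] at hfin
    exact (Finset.sum_le_sum fun j _ => (hlt j).le).trans hfin
  simp only [Finset.sum_sub_distrib, Finset.sum_const, Finset.card_range, nsmul_eq_mul] at key
  refine le_of_forall_pos_le_add fun ε hε => ?_
  -- The `N` errors then total at most `ε`, and `N = 0` causes no division by zero.
  have h1 := key (ε / (N + 1)) (by positivity)
  have h2 : (N : ℝ) * (ε / (N + 1)) ≤ ε := by
    rw [mul_div_assoc', div_le_iff₀ (by positivity)]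
    nlinarith
  linarith

theorem dualDist_le_geometric (hc : X.IsContraction ρ) {M : ℝ} (hM : 0 < M)
    (hh : ∀ x y, X.genCouplingTime ρ x y ≤ ENNReal.ofReal M * ρ x y) {d : ℝ≥0} (hd : 0 < d)
    (T : ℕ) {x y : E} (hxy : ρ x y ≠ ∞) :
    X.dualDist ρ ((T + 1 : ℕ) * d) x y ≤
      (M / d / (1 + M / d)) ^ T * (M / d) * (ρ x y).toReal := by
  have hK : 0 < M / d := div_pos hM (NNReal.coe_pos.2 hd)
  have h := le_geometric_of_sum_le (a := fun k : ℕ => X.dualDist ρ (k * d) x y) hK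
    (fun T N => sum_dualDist_le hc hK
      (fun x y hxy => sum_dualDist_le_dist hc hM hh hd N hxy) T hxy) T
  refine h.trans ?_
  rw [mul_assoc]
  gcongr
  exact dualDist_le_dist hc _ hxy

/-! ### The operator seminorm: submultiplicativity and decay rate. -/

theorem semigroupLipNorm_le_ofReal_iff (hc : X.IsContraction ρ) (t : ℝ≥0) {C : ℝ} (hC : 0 ≤ C) :
    X.semigroupLipNorm ρ t ≤ ENNReal.ofReal C ↔
      ∀ x y, ρ x y ≠ ∞ → X.dualDist ρ t x y ≤ C * (ρ x y).toReal := by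
  simp only [semigroupLipNorm, iSup_le_iff, lipSeminorm_le_ofReal_iff hC]
  constructor
  · intro h x y hxy
    refine dualDist_le fun f hf => h f hf.measurable (fun x => hf.integrable _) ?_ x y hxy
    rw [← ENNReal.ofReal_one, lipSeminorm_le_ofReal_iff zero_le_one]
    exact hf.lip
  · intro h f hf hint hlip x y hxy
    rw [← ENNReal.ofReal_one, lipSeminorm_le_ofReal_iff zero_le_one] at hlip
    -- Truncation at `±n` preserves the Lipschitz bound, and dominated convergence recovers `S_t f`;
    -- so bounded test functions suffice.
    have hlip' : ∀ n : ℕ, IsBddLip ρ 1 fun z => max (-(n : ℝ)) (min (f z) n) := by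
      intro n
      refine ⟨measurable_const.max (hf.min measurable_const), ⟨n, fun z => ?_⟩, fun z w hzw => ?_⟩
      · exact abs_le.2 ⟨le_max_left _ _, max_le (by linarith [n.cast_nonneg (α := ℝ)])
          (min_le_right _ _)⟩
      · have h0 : (0 : ℝ) ≤ 1 * (ρ z w).toReal := by simp
        have h1 := hlip z w hzw
        rw [sub_le_iff_le_add] at h1 ⊢
        refine max_le ?_ ?_
        · linarith [le_max_left (-(n : ℝ)) (min (f w) n)]
        · have := le_max_right (-(n : ℝ)) (min (f w) n)
          rcases min_choice (f w) n with h2 | h2 <;> rw [h2] at this ⊢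
          · linarith [min_le_left (f z) n]
          · linarith [min_le_right (f z) n]
    have htend : ∀ z, Tendsto (fun n : ℕ => X.semigroup t (fun z => max (-(n : ℝ)) (min (f z) n)) z)
        atTop (𝓝 (X.semigroup t f z)) := by
      intro z
      refine tendsto_integral_of_dominated_convergence (fun z => |f z|)
        (fun n => (hlip' n).measurable.aestronglyMeasurable) (hint z).abs
        (fun n => Eventually.of_forall fun w => ?_) (Eventually.of_forall fun w => ?_)
      · rw [Real.norm_eq_abs, abs_le]
        refine ⟨le_max_of_le_right (le_min (neg_abs_le _) ?_), max_le ?_ ?_⟩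
        · linarith [abs_nonneg (f w), n.cast_nonneg (α := ℝ)]
        · linarith [abs_nonneg (f w), n.cast_nonneg (α := ℝ)]
        · exact (min_le_left _ _).trans (le_abs_self _)
      · refine tendsto_const_nhds.congr' ?_
        filter_upwards [eventually_ge_atTop ⌈|f w|⌉₊] with n hn
        have := abs_le.1 (Nat.ceil_le.1 hn)
        rw [min_eq_left this.2, max_eq_right this.1]
    exact le_of_tendsto' ((htend x).sub (htend y)) fun n =>
      (semigroup_sub_le_dualDist hc (hlip' n) t hxy).trans (h x y hxy)

theorem semigroupLipNorm_le_one (hc : X.IsContraction ρ) (t : ℝ≥0) :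
    X.semigroupLipNorm ρ t ≤ 1 := by
  rw [← ENNReal.ofReal_one, semigroupLipNorm_le_ofReal_iff hc t zero_le_one]
  exact fun x y hxy => by simpa using dualDist_le_dist hc t hxy

theorem semigroupLipNorm_add_le (hc : X.IsContraction ρ) (s t : ℝ≥0) :
    X.semigroupLipNorm ρ (s + t) ≤ X.semigroupLipNorm ρ s * X.semigroupLipNorm ρ t := by
  have hfin : ∀ u, X.semigroupLipNorm ρ u ≠ ∞ := fun u =>
    ne_top_of_le_ne_top ENNReal.one_ne_top (semigroupLipNorm_le_one hc u)
  set a := (X.semigroupLipNorm ρ s).toReal with ha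
  set b := (X.semigroupLipNorm ρ t).toReal with hb
  have ha0 : 0 ≤ a := ENNReal.toReal_nonneg
  have hb0 : 0 ≤ b := ENNReal.toReal_nonneg
  have ea : X.semigroupLipNorm ρ s = ENNReal.ofReal a := (ENNReal.ofReal_toReal (hfin s)).symm
  have eb : X.semigroupLipNorm ρ t = ENNReal.ofReal b := (ENNReal.ofReal_toReal (hfin t)).symm
  have h1 := (semigroupLipNorm_le_ofReal_iff hc s ha0).1 ea.le
  have h2 := (semigroupLipNorm_le_ofReal_iff hc t hb0).1 eb.le
  rw [ea, eb, ← ENNReal.ofReal_mul ha0, semigroupLipNorm_le_ofReal_iff hc _ (by positivity)]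
  intro x y hxy
  -- `dualDist_add_le` needs a positive constant, while `b` may be `0`.
  have key : ∀ ε : ℝ, 0 < ε → X.dualDist ρ (s + t) x y ≤ (b + ε) * (a * (ρ x y).toReal) := by
    intro ε hε
    refine (dualDist_add_le hc (by linarith : 0 < b + ε) (fun x y h => (h2 x y h).trans ?_) s
      hxy).trans (mul_le_mul_of_nonneg_left (h1 x y hxy) (by linarith))
    exact mul_le_mul_of_nonneg_right (by linarith) ENNReal.toReal_nonneg
  have hlim : Tendsto (fun ε : ℝ => (b + ε) * (a * (ρ x y).toReal)) (𝓝[>] 0)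
      (𝓝 ((b + 0) * (a * (ρ x y).toReal))) :=
    ((continuous_const.add continuous_id).mul continuous_const).continuousAt.tendsto.mono_left
      nhdsWithin_le_nhds
  refine (ge_of_tendsto hlim (eventually_mem_nhdsWithin.mono fun ε hε => key ε hε)).trans_eq ?_
  ring

theorem exists_inv_mul_log_semigroupLipNorm_le (hc : X.IsContraction ρ) {M : ℝ} (hM : 0 < M)
    (hh : ∀ x y, X.genCouplingTime ρ x y ≤ ENNReal.ofReal M * ρ x y) {b : ℝ}
    (hb : -(1 / M) < b) (hb0 : b < 0) :
    ∃ t : ℝ≥0, 0 < t ∧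
      ((1 / (t : ℝ) : ℝ) : EReal) * ENNReal.log (X.semigroupLipNorm ρ t) ≤ (b : EReal) := by
  obtain ⟨d, hd, hlt⟩ := exists_pos_inv_one_add_lt_exp hM hb hb0
  lift d to ℝ≥0 using hd.le
  have hd' : 0 < d := NNReal.coe_pos.1 hd
  set K := M / d with hK
  have hK0 : 0 < K := div_pos hM hd
  set e := Real.exp (b * d) with he
  have he0 : 0 < e := Real.exp_pos _
  -- Since `K/(1+K) < e`, a large `T` absorbs both the prefactor `K` and the extra factor `e` from
  -- `T + 1` time steps against `T` powers.
  have hlim : Tendsto (fun T : ℕ => (K / (1 + K) / e) ^ T * K) atTop (𝓝 (0 * K)) :=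
    (tendsto_pow_atTop_nhds_zero_of_lt_one (by positivity) ((div_lt_one he0).2 hlt)).mul_const K
  rw [zero_mul] at hlim
  obtain ⟨T, hT⟩ := (hlim.eventually_lt_const he0).exists
  have ht : 0 < ((T + 1 : ℕ) : ℝ≥0) * d := by positivity
  refine ⟨_, ht, ?_⟩
  rw [inv_mul_log_le_iff (NNReal.coe_pos.2 ht)]
  have h1 : (K / (1 + K)) ^ T * K ≤ Real.exp (b * (((T + 1 : ℕ) : ℝ≥0) * d : ℝ≥0)) := by
    have h2 : Real.exp (b * (((T + 1 : ℕ) : ℝ≥0) * d : ℝ≥0)) = e ^ T * e := by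
      rw [← pow_succ, he, ← Real.exp_nat_mul]
      push_cast
      ring_nf
    rw [h2]
    rw [div_pow, div_mul_eq_mul_div, div_lt_iff₀ (by positivity)] at hT
    linarith
  refine le_trans ?_ (ENNReal.ofReal_le_ofReal h1)
  rw [semigroupLipNorm_le_ofReal_iff hc _ (by positivity)]
  exact fun x y hxy => dualDist_le_geometric hc hM hh hd' T hxy

end FellerProcess

end CouplingTime

theorem mainTheorem6 {E : Type*} [TopologicalSpace E] [PolishSpace E] [MeasurableSpace E]
    [BorelSpace E]
    (X : CouplingTime.FellerProcess E) (ρ : E → E → ℝ≥0∞) (hρ : CouplingTime.IsLscMetric ρ)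
    (hcontr : X.IsContraction ρ) (M : ℝ) (hM : 0 < M)
    (hh : ∀ x y, X.genCouplingTime ρ x y ≤ ENNReal.ofReal M * ρ x y) :
    ∃ L : EReal,
      Tendsto (fun t : ℝ≥0 => ((1 / (t : ℝ) : ℝ) : EReal) * ENNReal.log (X.semigroupLipNorm ρ t))
        atTop (𝓝 L) ∧
      L ≤ ((-(1 / M) : ℝ) : EReal) := by
  have hlim := CouplingTime.tendsto_inv_mul_log_of_submultiplicative
    (CouplingTime.FellerProcess.semigroupLipNorm_le_one hcontr)
    (CouplingTime.FellerProcess.semigroupLipNorm_add_le hcontr)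
  refine ⟨_, hlim, ?_⟩
  by_contra! hlt
  obtain ⟨c, hc1, hc2⟩ := EReal.lt_iff_exists_real_btwn.1 hlt
  have hM' : 0 < 1 / M := one_div_pos.2 hM
  -- The `min` makes the rate negative, as required, while keeping it above `-1/M` and at most `c`.
  obtain ⟨t, ht, hle⟩ := CouplingTime.FellerProcess.exists_inv_mul_log_semigroupLipNorm_le hcontr hM
    hh (b := min c (-(1 / M) / 2)) (lt_min (EReal.coe_lt_coe_iff.1 hc1) (by linarith))
    (min_lt_of_right_lt (by linarith))
  exact absurd ((iInf₂_le t ht).trans (hle.trans (EReal.coe_le_coe_iff.2 (min_le_left _ _))))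
    (not_le.2 hc2)
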